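/- For a positive integer $m$ let $\zeta_m=e^{2\pi i/m}$, $G_m=\operatorname{Gal}(\mathbb{Q}(\zeta_m)/\mathbb{Q})$, and $N_m=\sum_{\tau\in G_m}\tau\in\mathbb{Q}[G_m]$. For $s$ prime to $m$ let $\sigma_{m,s}\in G_m$ be the automorphism sending every $m$-th root of unity to its $s$-th power, and for $a\in\mathbb{Z}$ put $$\theta_m(a)=\sum_{\substack{0<s\le m\\ \gcd(s,m)=1}}\left\langle-\frac{as}{m}\right\rangle\sigma_{m,s}^{-1}\in\mathbb{Q}[G_m],$$ where $\langle x\rangle$ is the fractional part of $x$. Put $\omega_m(a)=\theta_m(a)-\tfrac12N_m$ if $m\nmid a$ and $\omega_m(a)=0$ if $m\mid a$. For $d\mid n$ let $\operatorname{res}_{n,d}:\mathbb{Q}[G_n]\to\mathbb{Q}[G_d]$ be the ring homomorphism sending each $\sigma\in G_n$ to its restriction $\sigma|_{\mathbb{Q}(\zeta_d)}$, and for $d\mid m$ let $\operatorname{cor}_{m,d}:\mathbb{Q}[G_d]\to\mathbb{Q}[G_m]$ be the $\mathbb{Q}$-linear map sending each $\tau\in G_d$ to $\sum_{\sigma\in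 G_m,\ \sigma|_{\mathbb{Q}(\zeta_d)}=\tau}\sigma$. Let $S'_m$ (Sinnott's group) be the subgroup of the additive group of $\mathbb{Q}[G_m]$ generated by the elements $$\operatorname{cor}_{m,d}\bigl(\operatorname{res}_{n,d}(\theta_n(a))\bigr),\qquad d=\gcd(m,n),$$ for all integers $a$ and all positive integers $n$. **Theorem.** For any prime power $q=p^e>2$ ($p$ prime, $e\ge1$), the elements $\omega_q(a)$, $1\le a\le\varphi(q)/2$, together with $\tfrac12N_q$, form a $\mathbb{Z}$-basis of $S'_q$. -/

import Mathlib

noncomputable section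

namespace Stickelberger

/-- The `m`-th cyclotomic field `ℚ(ζ_m)`, `ζ_m = exp (2πi/m)`, as a subfield of `ℂ`. -/
def Cyc (m : ℕ) : IntermediateField ℚ ℂ :=
  IntermediateField.adjoin ℚ {Complex.exp (2 * Real.pi * Complex.I / m)}

instance isCyclotomicExtension_cyc (m : ℕ) [NeZero m] :
    IsCyclotomicExtension {m} ℚ (Cyc m) := by
  have hζ := Complex.isPrimitiveRoot_exp m (NeZero.ne m)
  change IsCyclotomicExtension {m} ℚ (Cyc m).toSubalgebra
  rw [Cyc, IntermediateField.adjoin_simple_toSubalgebra_of_isAlgebraic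
    (hζ.isIntegral (NeZero.pos m)).tower_top.isAlgebraic]
  exact hζ.adjoin_isCyclotomicExtension ℚ

instance finiteDimensional_cyc (m : ℕ) [NeZero m] : FiniteDimensional ℚ (Cyc m) :=
  IsCyclotomicExtension.finiteDimensional {m} ℚ (Cyc m)

instance isGalois_cyc (m : ℕ) [NeZero m] : IsGalois ℚ (Cyc m) :=
  IsCyclotomicExtension.isGalois {m} ℚ (Cyc m)

/-- The Galois group `G_m` of `ℚ(ζ_m)` over `ℚ`. -/
abbrev G (m : ℕ) : Type := Gal(Cyc m/ℚ)

/-- The rational group ring `ℚ[G_m]`. -/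
abbrev GroupRing (m : ℕ) : Type := MonoidAlgebra ℚ (G m)

theorem cyc_le_cyc {d n : ℕ} [NeZero n] (h : d ∣ n) : Cyc d ≤ Cyc n := by
  obtain ⟨k, rfl⟩ := h
  have h0 : d * k ≠ 0 := NeZero.ne (d * k)
  have hk : (k : ℂ) ≠ 0 := by exact_mod_cast right_ne_zero_of_mul h0
  have hd : (d : ℂ) ≠ 0 := by exact_mod_cast left_ne_zero_of_mul h0
  rw [Cyc, Cyc, IntermediateField.adjoin_simple_le_iff]
  have e : Complex.exp (2 * Real.pi * Complex.I / d)
      = Complex.exp (2 * Real.pi * Complex.I / ((d * k : ℕ) : ℂ)) ^ k := by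
    rw [← Complex.exp_nat_mul]
    congr 1
    push_cast
    field_simp
  rw [e]
  exact pow_mem (IntermediateField.mem_adjoin_simple_self ℚ _) k

/-- Restriction along a `K`-embedding `f : E → F` of fields with `E` normal over `K`: each
`σ ∈ Gal(F/K)` is sent to the automorphism of `E` that `σ` induces through `f`. -/
def restrictAlong {K E F : Type*} [Field K] [Field E] [Field F] [Algebra K E] [Algebra K F]
    [Normal K E] (f : E →ₐ[K] F) : Gal(F/K) →* Gal(E/K) :=
  letI : Algebra E F := f.toRingHom.toAlgebra
  haveI : IsScalarTower K E F := IsScalarTower.of_algebraMap_eq fun x => (f.commutes x).symm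
  AlgEquiv.restrictNormalHom E

theorem restrictAlong_apply {K E F : Type*} [Field K] [Field E] [Field F] [Algebra K E]
    [Algebra K F] [Normal K E] (f : E →ₐ[K] F) (σ : Gal(F/K)) (x : E) :
    f (restrictAlong f σ x) = σ (f x) := by
  let _ : Algebra E F := f.toRingHom.toAlgebra
  have _ : IsScalarTower K E F := IsScalarTower.of_algebraMap_eq fun x => (f.commutes x).symm
  exact AlgEquiv.restrictNormal_commutes σ E x

/-- The inclusion `E ⊆ F` of subfields of `ℂ` as a homomorphism of `ℚ`-algebras. -/
def inclusionRat {E F : IntermediateField ℚ ℂ} (h : E ≤ F) : E →ₐ[ℚ] F :=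
  (IntermediateField.inclusion h).toRingHom.toRatAlgHom

theorem coe_inclusionRat {E F : IntermediateField ℚ ℂ} (h : E ≤ F) (x : E) :
    (inclusionRat h x : ℂ) = x := rfl

/-- The inclusion `ℚ(ζ_d) ⊆ ℚ(ζ_n)` for `d ∣ n`. -/
def incl {d n : ℕ} [NeZero n] (h : d ∣ n) : Cyc d →ₐ[ℚ] Cyc n :=
  inclusionRat (cyc_le_cyc h)

theorem coe_incl {d n : ℕ} [NeZero n] (h : d ∣ n) (x : Cyc d) : (incl h x : ℂ) = x :=
  coe_inclusionRat (cyc_le_cyc h) x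

theorem coe_restrictAlong_inclusionRat {E F : IntermediateField ℚ ℂ} [Normal ℚ E] (h : E ≤ F)
    (σ : Gal(F/ℚ)) (x : E) :
    (restrictAlong (inclusionRat h) σ x : ℂ) = σ (inclusionRat h x) :=
  congrArg Subtype.val (restrictAlong_apply (inclusionRat h) σ x)

/-- The restriction homomorphism `G_n → G_d`, `σ ↦ σ|_{ℚ(ζ_d)}`, for `d ∣ n`. -/
def restrictGal {d n : ℕ} [NeZero d] [NeZero n] (h : d ∣ n) : G n →* G d :=
  restrictAlong (incl h)

/-- `restrictGal h σ` acts on the elements of `ℚ(ζ_d)` as `σ` does. -/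
theorem coe_restrictGal_apply {d n : ℕ} [NeZero d] [NeZero n] (h : d ∣ n) (σ : G n) (x : Cyc d) :
    (restrictGal h σ x : ℂ) = σ (incl h x) :=
  coe_restrictAlong_inclusionRat (cyc_le_cyc h) σ x

/-- The automorphism `σ_s ∈ G_m` sending every `m`-th root of unity to its `s`-th power, for `s`
prime to `m` (see `sigma_apply`). The value at other `s` is not used. -/
def sigma (m : ℕ) [NeZero m] (s : ℕ) : G m :=
  if h : s.Coprime m then
    (IsCyclotomicExtension.autEquivPow (Cyc m)
      (Polynomial.cyclotomic.irreducible_rat (NeZero.pos m))).symm (ZMod.unitOfCoprime s h)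
  else 1

theorem sigma_apply (m : ℕ) [NeZero m] {s : ℕ} (hs : s.Coprime m) {z : Cyc m} (hz : z ^ m = 1) :
    sigma m s z = z ^ s := by
  have hζ := IsCyclotomicExtension.zeta_spec m ℚ (Cyc m)
  have hirr := Polynomial.cyclotomic.irreducible_rat (NeZero.pos m)
  have key := hζ.autToPow_spec ℚ (sigma m s)
  have h2 : hζ.autToPow ℚ (sigma m s) = ZMod.unitOfCoprime s hs := by
    have := (IsCyclotomicExtension.autEquivPow (Cyc m) hirr).apply_symm_apply
      (ZMod.unitOfCoprime s hs)
    rw [sigma, dif_pos hs]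
    exact this
  rw [h2, ZMod.coe_unitOfCoprime, ZMod.val_natCast] at key
  have h3 : sigma m s (IsCyclotomicExtension.zeta m ℚ (Cyc m))
      = IsCyclotomicExtension.zeta m ℚ (Cyc m) ^ s := by
    rw [← key]
    conv_rhs => rw [← Nat.mod_add_div s m, pow_add, pow_mul, hζ.pow_eq_one, one_pow, mul_one]
  obtain ⟨i, -, rfl⟩ := hζ.eq_pow_of_pow_eq_one hz
  rw [map_pow, h3, ← pow_mul, ← pow_mul, mul_comm]

/-- `θ_m(a) = ∑_{0 < s ≤ m, (s, m) = 1} ⟨-as/m⟩ σ_s⁻¹`, where `⟨x⟩` is the fractional part. -/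
def theta (m : ℕ) [NeZero m] (a : ℤ) : GroupRing m :=
  ∑ s ∈ (Finset.Ioc 0 m).filter (fun s => s.Coprime m),
    MonoidAlgebra.single (sigma m s)⁻¹ (Int.fract (-((a : ℚ) * s / m)))

/-- The absolute norm element `N_m = ∑_{τ ∈ G_m} τ`. -/
def normElt (m : ℕ) [NeZero m] : GroupRing m :=
  ∑ τ : G m, MonoidAlgebra.single τ 1

/-- The restriction map `ℚ[G_n] → ℚ[G_d]` for `d ∣ n`: the `ℚ`-algebra homomorphism sending each
`σ` to its restriction to `ℚ(ζ_d)`. -/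
def res {d n : ℕ} [NeZero d] [NeZero n] (h : d ∣ n) : GroupRing n →ₐ[ℚ] GroupRing d :=
  MonoidAlgebra.mapDomainAlgHom ℚ ℚ (restrictGal h)

open Classical in
/-- The corestriction map `ℚ[G_d] → ℚ[G_m]` for `d ∣ m`: the `ℚ`-linear map sending each `τ` to the
sum of all `σ ∈ G_m` whose restriction to `ℚ(ζ_d)` is `τ`. -/
def cor {d m : ℕ} [NeZero d] [NeZero m] (h : d ∣ m) : GroupRing d →ₗ[ℚ] GroupRing m :=
  (Finsupp.linearCombination ℚ fun τ : G d =>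
      ∑ σ ∈ Finset.univ.filter (fun σ : G m => restrictGal h σ = τ),
        (MonoidAlgebra.single σ 1 : GroupRing m)) ∘ₗ
    (MonoidAlgebra.coeffLinearEquiv ℚ).toLinearMap

instance neZero_gcd (m n : ℕ) [NeZero m] : NeZero (Nat.gcd m n) :=
  ⟨Nat.gcd_ne_zero_left (NeZero.ne m)⟩

/-- `θ_n^{(m)}(a)`, obtained from `θ_n(a)` by restriction to `ℚ(ζ_{(m, n)})` followed by
corestriction to `ℚ(ζ_m)`. -/
def thetaUp (m n : ℕ) [NeZero m] [NeZero n] (a : ℤ) : GroupRing m :=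
  cor (Nat.gcd_dvd_left m n) (res (Nat.gcd_dvd_right m n) (theta n a))

/-- Sinnott's group `S'_m`: the additive subgroup of `ℚ[G_m]` generated by all `θ_n^{(m)}(a)` with
`a ∈ ℤ` and `n` a positive integer. -/
def SPrime (m : ℕ) [NeZero m] : AddSubgroup (GroupRing m) :=
  AddSubgroup.closure {x | ∃ (n : ℕ) (_ : NeZero n) (a : ℤ), x = thetaUp m n a}

/-- `ω_m(a) = θ_m(a) - ½ N_m` if `m ∤ a`, and `ω_m(a) = 0` if `m ∣ a`. -/
def omega (m : ℕ) [NeZero m] (a : ℤ) : GroupRing m :=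
  if (m : ℤ) ∣ a then 0 else theta m a - (1 / 2 : ℚ) • normElt m

/-- `M'_q = {1, …, φ(q)/2}`; here `φ(q)` is even for every `q > 2`. -/
def MPrime (q : ℕ) : Set ℤ := Set.Icc 1 ((Nat.totient q / 2 : ℕ) : ℤ)

end Stickelberger

end

/-! ### Abel summation and the exponential zeta function at 1 -/

noncomputable section
namespace Stickelberger

open Filter Topology Complex

/-! Reading off the coefficient of σ_u⁻¹ (`coeffFun`) identifies ℚ[G_m] with the functions on
(ℤ/m)ˣ. Then ω_m(a) becomes `sawFun m a`, N_m becomes the constant 1, res becomes summation over the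
fibres of reduction, and cor becomes pullback along reduction. The algebra rests on the distribution
relation `sum_saw_filter_castHom_eq`: the sawtooth summed over the lifts of a residue class is the
sawtooth at the lower level.

Generation. The distribution relation makes the groups `sawSpan` stable under fibre sums and
pullbacks, so every generator of S'_q lies in the group generated by `sawSpan q` and the constant ½.
For q = p^e, the relations ω(-a) = -ω(a) and ∑ ω(y) = ω(px), over y ≡ x mod q/p, reduce every a to
the range 1 ≤ a ≤ φ(q)/2 (`sawFun_mem_of_forall_le`).

Independence. The complex span of the family contains the constant 1 and every odd character χ:
averaging sawtooth functions against χ⁻¹ gives χ times a generalized Bernoulli sum, which is nonzero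
for a suitable argument because L(1, χ) ≠ 0 (`exists_sum_char_mul_saw_ne_zero`). These are φ(q)/2 +
1 independent functions, as many as the family has members. -/

theorem sum_range_mul_eq_summation_by_parts {R : Type*} [CommRing R] (b c : ℕ → R) (n : ℕ) :
    ∑ i ∈ Finset.range n, b i * c i =
      ∑ i ∈ Finset.range n, (∑ j ∈ Finset.range (i + 1), b j) * (c i - c (i + 1)) +
        (∑ j ∈ Finset.range n, b j) * c n := by
  induction n with
  | zero => simp
  | succ n ih =>
    rw [Finset.sum_range_succ, ih, Finset.sum_range_succ _ n, Finset.sum_range_succ b n]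
    ring

/-- Supplies a summable majorant uniform in s. With r = (n+1)/(n+2) the difference is (n+1)^(-s) (1
- r^s), and 1 - r^s ≤ 1 - r² ≤ 2(1 - r). -/
theorem abs_rpow_neg_sub_le (n : ℕ) {s : ℝ} (h1 : 1 ≤ s) (h2 : s ≤ 2) :
    |((n : ℝ) + 1) ^ (-s) - ((n + 1 : ℕ) + 1 : ℝ) ^ (-s)| ≤ 2 * (1 / ((n : ℝ) + 1) ^ 2) := by
  have hx : (0 : ℝ) < n + 1 := by positivity
  have hy : (0 : ℝ) < (n + 1 : ℕ) + 1 := by positivity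
  set r : ℝ := (n + 1) / ((n + 1 : ℕ) + 1) with hr
  have hr0 : 0 < r := by positivity
  have hr1 : r ≤ 1 := by rw [hr, div_le_one hy]; push_cast; linarith
  have e : ((n + 1 : ℕ) + 1 : ℝ) ^ (-s) = (n + 1 : ℝ) ^ (-s) * r ^ s := by
    rw [hr, Real.div_rpow hx.le hy.le, Real.rpow_neg hx.le, Real.rpow_neg hy.le]
    have := (Real.rpow_pos_of_pos hx s).ne'
    field_simp
  have h3 : r ^ 2 ≤ r ^ s := by
    rw [← Real.rpow_two]
    exact Real.rpow_le_rpow_of_exponent_ge hr0 hr1 h2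
  have h4 : r ^ s ≤ 1 := Real.rpow_le_one hr0.le hr1 (by linarith)
  have h5 : (n + 1 : ℝ) ^ (-s) ≤ (n + 1 : ℝ)⁻¹ := by
    rw [← Real.rpow_neg_one]
    exact Real.rpow_le_rpow_of_exponent_le (by linarith [n.cast_nonneg (α := ℝ)]) (by linarith)
  have h6 : 0 ≤ (n + 1 : ℝ) ^ (-s) := Real.rpow_nonneg hx.le _
  have h7 : 1 - r ^ 2 ≤ 2 * (n + 1 : ℝ)⁻¹ := by
    have : 1 - r ≤ (n + 1 : ℝ)⁻¹ := by
      rw [hr, one_sub_div hy.ne', ← one_div]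
      push_cast
      gcongr <;> linarith
    nlinarith
  rw [e, ← mul_one_sub, abs_of_nonneg (mul_nonneg h6 (by linarith))]
  calc _ ≤ (n + 1 : ℝ)⁻¹ * (2 * (n + 1 : ℝ)⁻¹) :=
        mul_le_mul h5 (by linarith) (by linarith) (by positivity)
    _ = _ := by field_simp

/-- Summation by parts gives a series dominated uniformly on 1 ≤ s ≤ 2, so s → 1⁺ may be taken
termwise although the series at s = 1 need not converge absolutely. -/
theorem tendsto_sum_div_of_bounded_of_hasSum {b : ℕ → ℂ} {C : ℝ} {F : ℂ → ℂ}
    (hb : ∀ n, ‖∑ i ∈ Finset.range n, b i‖ ≤ C) (hF : ContinuousAt F 1)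
    (h : ∀ s : ℝ, 1 < s → HasSum (fun n : ℕ => b n / ((n : ℂ) + 1) ^ (s : ℂ)) (F s)) :
    Tendsto (fun n => ∑ i ∈ Finset.range n, b i / ((i : ℂ) + 1)) atTop (𝓝 (F 1)) := by
  let c : ℝ → ℕ → ℂ := fun s n => (((n : ℝ) + 1) ^ (-s) : ℝ)
  let D : ℝ → ℕ → ℂ := fun s n => (∑ j ∈ Finset.range (n + 1), b j) * (c s n - c s (n + 1))
  have hD : ∀ s n, 1 ≤ s → s ≤ 2 → ‖D s n‖ ≤ C * (2 * (1 / ((n : ℝ) + 1) ^ 2)) := by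
    intro s n h1 h2
    rw [norm_mul]
    refine mul_le_mul (hb _) ?_ (norm_nonneg _) ((norm_nonneg _).trans (hb 0))
    rw [← ofReal_sub, norm_real, Real.norm_eq_abs]
    exact abs_rpow_neg_sub_le n h1 h2
  have hsum : Summable fun n : ℕ => C * (2 * (1 / ((n : ℝ) + 1) ^ 2)) := by
    refine Summable.mul_left _ (Summable.mul_left _ ?_)
    exact_mod_cast (summable_nat_add_iff 1).mpr (Real.summable_one_div_nat_pow.mpr one_lt_two)
  have hpart : ∀ s, 1 ≤ s → s ≤ 2 →
      Tendsto (fun n => ∑ i ∈ Finset.range n, b i * c s i) atTop (𝓝 (∑' n, D s n)) := by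
    intro s h1 h2
    have t1 := (Summable.of_norm_bounded hsum fun n => hD s n h1 h2).hasSum.tendsto_sum_nat
    have t2 : Tendsto (c s) atTop (𝓝 0) := by
      have : Tendsto (fun n : ℕ => ((n : ℝ) + 1) ^ (-s)) atTop (𝓝 0) :=
        (tendsto_rpow_neg_atTop (by linarith)).comp
          (tendsto_atTop_add_const_right _ _ tendsto_natCast_atTop_atTop)
      exact (continuous_ofReal.tendsto' 0 0 ofReal_zero).comp this
    have t3 : Tendsto (fun n => (∑ j ∈ Finset.range n, b j) * c s n) atTop (𝓝 0) := by
      rw [tendsto_zero_iff_norm_tendsto_zero] at t2 ⊢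
      refine squeeze_zero (fun _ => norm_nonneg _) (fun n => ?_)
        (by simpa using t2.const_mul C)
      rw [norm_mul]
      exact mul_le_mul_of_nonneg_right (hb n) (norm_nonneg _)
    rw [← add_zero (∑' n, D s n)]
    exact (t1.add t3).congr fun n => (sum_range_mul_eq_summation_by_parts b (c s) n).symm
  have hFs : ∀ s : ℝ, 1 < s → s ≤ 2 → F s = ∑' n, D s n := by
    intro s h1 h2
    refine tendsto_nhds_unique ((h s h1).tendsto_sum_nat.congr fun n => ?_) (hpart s h1.le h2)
    refine Finset.sum_congr rfl fun i _ => ?_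
    simp only [c]
    rw [Real.rpow_neg (by positivity), ofReal_inv, ofReal_cpow (by positivity), div_eq_mul_inv]
    norm_cast
  have hlim : Tendsto (fun s : ℝ => ∑' n, D s n) (𝓝[>] 1) (𝓝 (∑' n, D 1 n)) := by
    refine tendsto_tsum_of_dominated_convergence hsum (fun n => ?_) ?_
    · have : Continuous fun s => D s n := by
        refine continuous_const.mul ?_
        refine Continuous.sub ?_ ?_ <;>
        exact continuous_ofReal.comp (continuous_const.rpow continuous_neg
          fun _ => Or.inl (by positivity))
      exact (this.tendsto 1).mono_left nhdsWithin_le_nhds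
    · filter_upwards [Ioc_mem_nhdsGT (show (1 : ℝ) < 2 by norm_num)] with s hs n
      exact hD s n hs.1.le hs.2
  have hF' : Tendsto (fun s : ℝ => F s) (𝓝[>] 1) (𝓝 (F 1)) := by
    have : Tendsto (fun s : ℝ => (s : ℂ)) (𝓝[>] 1) (𝓝 1) :=
      (continuous_ofReal.tendsto' 1 1 (by simp)).mono_left nhdsWithin_le_nhds
    exact hF.tendsto.comp this
  have key : F 1 = ∑' n, D 1 n := by
    refine tendsto_nhds_unique hF' (hlim.congr' ?_)
    filter_upwards [Ioc_mem_nhdsGT (show (1 : ℝ) < 2 by norm_num)] with s hs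
    exact (hFs s hs.1 hs.2).symm
  rw [key]
  refine (hpart 1 le_rfl one_le_two).congr fun n => Finset.sum_congr rfl fun i _ => ?_
  simp only [c]
  rw [Real.rpow_neg_one, div_eq_mul_inv]
  push_cast
  rfl

/-- Abel's limit theorem: once the series converges at z, its sum is the radial limit of the Taylor
series of the logarithm, which is continuous at 1 - z. -/
theorem eq_neg_log_one_sub_of_tendsto {z l : ℂ} (hz : ‖z‖ = 1) (hz1 : z ≠ 1)
    (h : Tendsto (fun n => ∑ i ∈ Finset.range n, z ^ (i + 1) / ((i : ℂ) + 1)) atTop (𝓝 l)) :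
    l = -log (1 - z) := by
  have h' : Tendsto (fun n => ∑ i ∈ Finset.range n, z ^ i / (i : ℂ)) atTop (𝓝 l) := by
    rw [← tendsto_add_atTop_iff_nat 1]
    refine h.congr fun n => ?_
    rw [Finset.sum_range_succ']
    simp
  have t := Complex.tendsto_tsum_powerSeries_nhdsWithin_lt h'
  rw [tendsto_map'_iff] at t
  have hslit : 1 - z ∈ slitPlane := by
    left
    have h1 : z.re ≤ 1 := hz ▸ re_le_norm z
    have h2 : z.re ≠ 1 := fun h2 => hz1 <| by
      have := Complex.sq_norm_sub_sq_re z
      rw [hz, h2] at this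
      exact Complex.ext h2 (by simpa using this.symm)
    simpa using lt_of_le_of_ne h1 h2
  have c : Tendsto (fun r : ℝ => -log (1 - z * r)) (𝓝[<] 1) (𝓝 (-log (1 - z))) := by
    have : ContinuousAt (fun r : ℝ => -log (1 - z * r)) 1 := by
      refine ContinuousAt.neg (ContinuousAt.clog (by fun_prop) (by simpa using hslit))
    simpa using this.tendsto.mono_left (nhdsWithin_le_nhds (s := Set.Iio 1))
  refine tendsto_nhds_unique (Tendsto.congr' ?_ t) c
  filter_upwards [Ioo_mem_nhdsLT (show (0 : ℝ) < 1 by norm_num)] with r hr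
  have hn : ‖z * r‖ < 1 := by
    rw [norm_mul, hz, one_mul, norm_real, Real.norm_eq_abs, abs_of_pos hr.1]
    exact hr.2
  rw [← (hasSum_taylorSeries_neg_log hn).tsum_eq]
  refine tsum_congr fun n => ?_
  rw [mul_pow]
  ring

theorem norm_geom_sum_le {z : ℂ} (hz : ‖z‖ = 1) (hz1 : z ≠ 1) (n : ℕ) :
    ‖∑ i ∈ Finset.range n, z ^ (i + 1)‖ ≤ 2 / ‖z - 1‖ := by
  have h0 : 0 < ‖z - 1‖ := norm_pos_iff.mpr (sub_ne_zero.mpr hz1)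
  simp_rw [pow_succ]
  rw [← Finset.sum_mul, norm_mul, hz, mul_one, geom_sum_eq hz1, norm_div]
  gcongr
  calc _ ≤ ‖z ^ n‖ + ‖(1 : ℂ)‖ := norm_sub_le _ _
    _ = 2 := by rw [norm_pow, hz]; norm_num

theorem expZeta_one {x : ℝ} (hx : (x : UnitAddCircle) ≠ 0) :
    HurwitzZeta.expZeta x 1 = -log (1 - exp (2 * Real.pi * I * x)) := by
  set z := exp (2 * Real.pi * I * x) with hzdef
  have hz : ‖z‖ = 1 := by
    rw [hzdef, show 2 * Real.pi * I * x = ((2 * Real.pi * x : ℝ) : ℂ) * I by push_cast; ring]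
    exact norm_exp_ofReal_mul_I _
  have hz1 : z ≠ 1 := by
    intro h
    obtain ⟨n, hn⟩ := exp_eq_one_iff.mp h
    apply hx
    rw [AddCircle.coe_eq_zero_iff]
    refine ⟨n, ?_⟩
    have h2 : (2 * Real.pi * I : ℂ) ≠ 0 := two_pi_I_ne_zero
    rw [mul_comm (n : ℂ)] at hn
    have := mul_left_cancel₀ h2 hn
    rw [zsmul_one]
    exact_mod_cast this.symm
  refine eq_neg_log_one_sub_of_tendsto hz hz1 ?_
  refine tendsto_sum_div_of_bounded_of_hasSum (norm_geom_sum_le hz hz1)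
    (HurwitzZeta.differentiable_expZeta_of_ne_zero hx).continuous.continuousAt fun s hs => ?_
  have := HurwitzZeta.hasSum_expZeta_of_one_lt_re x (s := s) (by simpa using hs)
  rw [← hasSum_nat_add_iff' 1] at this
  have hs0 : (s : ℂ) ≠ 0 := by exact_mod_cast (by linarith : s ≠ 0)
  simp only [Finset.range_one, Finset.sum_singleton, Nat.cast_zero, zero_cpow hs0, div_zero,
    sub_zero] at this
  refine this.congr_fun fun n => ?_
  rw [hzdef, ← exp_nat_mul]
  push_cast
  ring_nf

/-- The polar form 2 sin(πx) e^{iπ(x - 1/2)}, from which the argument is read off when 0 < x < 1. -/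
theorem one_sub_exp_eq (x : ℝ) : 1 - exp (2 * Real.pi * I * x) =
    (2 * Real.sin (Real.pi * x) : ℝ) * (Real.cos (Real.pi * (x - 1 / 2)) +
      Real.sin (Real.pi * (x - 1 / 2)) * I) := by
  have e1 : exp (2 * Real.pi * I * x) = Real.cos (2 * (Real.pi * x)) +
      Real.sin (2 * (Real.pi * x)) * I := by
    rw [ofReal_cos, ofReal_sin, ← exp_mul_I]
    push_cast
    ring_nf
  have e2 : Real.cos (Real.pi * (x - 1 / 2)) = Real.sin (Real.pi * x) := by
    rw [← Real.cos_sub_pi_div_two]; ring_nf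
  have e3 : Real.sin (Real.pi * (x - 1 / 2)) = -Real.cos (Real.pi * x) := by
    rw [← Real.sin_sub_pi_div_two]; ring_nf
  rw [e1, e2, e3, Real.cos_two_mul, Real.sin_two_mul, Real.cos_sq']
  push_cast
  ring

theorem log_one_sub_exp_im {x : ℝ} (h0 : 0 < x) (h1 : x < 1) :
    (log (1 - exp (2 * Real.pi * I * x))).im = Real.pi * (x - 1 / 2) := by
  have hs : 0 < 2 * Real.sin (Real.pi * x) := by
    have := Real.sin_pos_of_pos_of_lt_pi (x := Real.pi * x) (by positivity)
      (by nlinarith [Real.pi_pos])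
    positivity
  rw [log_im, one_sub_exp_eq, ofReal_cos, ofReal_sin]
  exact arg_mul_cos_add_sin_mul_I hs ⟨by nlinarith [Real.pi_pos], by nlinarith [Real.pi_pos]⟩

/-- The two logarithms are complex conjugates, so only the imaginary part survives, and it is linear
in x. -/
theorem expZeta_neg_sub_expZeta_one {x : ℝ} (h0 : 0 < x) (h1 : x < 1) :
    HurwitzZeta.expZeta (-(x : UnitAddCircle)) 1 - HurwitzZeta.expZeta x 1 =
      -(2 * Real.pi * I) * (1 / 2 - x) := by
  have hx : (x : UnitAddCircle) ≠ 0 := by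
    rw [Ne, AddCircle.coe_eq_zero_iff]
    rintro ⟨n, hn⟩
    rw [zsmul_one] at hn
    rw [← hn] at h0 h1
    have : (0 : ℤ) < n := by exact_mod_cast h0
    have : n < (1 : ℤ) := by exact_mod_cast h1
    omega
  have hx' : ((-x : ℝ) : UnitAddCircle) ≠ 0 := by simpa using hx
  have e : log (1 - exp (2 * Real.pi * I * (-x : ℝ))) =
      (starRingEnd ℂ) (log (1 - exp (2 * Real.pi * I * x))) := by
    rw [← log_conj]
    · congr 1
      simp only [map_sub, map_one, ← exp_conj, map_mul, conj_ofReal, conj_I, map_ofNat]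
      push_cast
      ring_nf
    · rw [← log_im, log_one_sub_exp_im h0 h1]
      nlinarith [Real.pi_pos]
  rw [← AddCircle.coe_neg, expZeta_one hx, expZeta_one hx', e]
  have h := log_one_sub_exp_im h0 h1
  rw [neg_sub_neg, sub_conj, h]
  push_cast
  ring

/-- The sawtooth function `1/2 - ⟨x/n⟩`, extended by zero at `x = 0`. -/
def saw (n : ℕ) (x : ZMod n) : ℚ := if x = 0 then 0 else 1 / 2 - (x.val : ℚ) / n

theorem saw_zero (n : ℕ) : saw n 0 = 0 := if_pos rfl

theorem saw_neg (n : ℕ) [NeZero n] (x : ZMod n) : saw n (-x) = -saw n x := by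
  rcases eq_or_ne x 0 with rfl | h
  · simp [saw]
  · have hn : (n : ℚ) ≠ 0 := NeZero.ne _
    have : NeZero x := ⟨h⟩
    rw [saw, saw, if_neg h, if_neg (neg_ne_zero.mpr h), ZMod.val_neg_of_ne_zero,
      Nat.cast_sub (ZMod.val_lt x).le]
    field_simp
    ring

/-! ### Odd L-values at 1 as sawtooth sums -/

theorem expZeta_neg_sub_expZeta_one_eq_saw {n : ℕ} [NeZero n] (j : ZMod n) :
    HurwitzZeta.expZeta (ZMod.toAddCircle (-j)) 1 - HurwitzZeta.expZeta (ZMod.toAddCircle j) 1 =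
      -(2 * Real.pi * I) * (saw n j : ℂ) := by
  rcases eq_or_ne j 0 with rfl | h
  · simp [saw]
  · rw [map_neg, ZMod.toAddCircle_apply, saw, if_neg h, expZeta_neg_sub_expZeta_one]
    · push_cast; rfl
    · have : 0 < j.val := ZMod.val_pos.mpr h
      have := NeZero.pos n
      positivity
    · rw [div_lt_one (by exact_mod_cast NeZero.pos n)]
      exact_mod_cast ZMod.val_lt j

/-- Pairing j with -j replaces `expZeta` by half its odd part, which is a multiple of the sawtooth.
-/
theorem LFunction_dft_one_of_odd {n : ℕ} [NeZero n] {Φ : ZMod n → ℂ} (hΦ : Φ.Odd) :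
    ZMod.LFunction (ZMod.dft Φ) 1 = -(Real.pi * I) * ∑ j, Φ j * (saw n j : ℂ) := by
  have h0 : Φ 0 = 0 := by
    have := hΦ 0
    rw [neg_zero] at this
    exact self_eq_neg.mp this
  rw [ZMod.LFunction_dft Φ (Or.inl h0)]
  have e : ∑ j, Φ j * HurwitzZeta.expZeta (ZMod.toAddCircle (-j)) 1 =
      -∑ j, Φ j * HurwitzZeta.expZeta (ZMod.toAddCircle j) 1 := by
    rw [← Finset.sum_neg_distrib]
    refine Fintype.sum_equiv (Equiv.neg _) _ _ fun j => ?_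
    rw [Equiv.neg_apply, hΦ j]
    ring
  have e2 : ∑ j, Φ j * HurwitzZeta.expZeta (ZMod.toAddCircle (-j)) 1 -
      ∑ j, Φ j * HurwitzZeta.expZeta (ZMod.toAddCircle j) 1 =
      -(2 * Real.pi * I) * ∑ j, Φ j * (saw n j : ℂ) := by
    rw [← Finset.sum_sub_distrib, Finset.mul_sum]
    refine Finset.sum_congr rfl fun j _ => ?_
    rw [← mul_sub, expZeta_neg_sub_expZeta_one_eq_saw]
    ring
  linear_combination (1 / 2) * e + (1 / 2) * e2

/-- If all these sums vanished, averaging over units would give ∑ Φ(j) saw(j) = 0 for Φ the Fourier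
transform of χ⁻¹; but this sum is a nonzero multiple of L(1, χ⁻¹). A general j is needed because for
imprimitive χ the choice j = 1 can fail. -/
theorem exists_sum_char_mul_saw_ne_zero {n : ℕ} [NeZero n] {χ : DirichletCharacter ℂ n}
    (hχ : χ.Odd) : ∃ j : ZMod n, ∑ u : (ZMod n)ˣ, χ u * (saw n (j * u) : ℂ) ≠ 0 := by
  by_contra! H
  have hne : χ⁻¹ ≠ 1 := by
    intro h
    rw [inv_eq_one] at h
    rw [h, DirichletCharacter.Odd, MulChar.one_apply (isUnit_one.neg)] at hχ
    norm_num at hχ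
  have hodd : (χ⁻¹ : DirichletCharacter ℂ n).Odd := by
    rw [DirichletCharacter.Odd, MulChar.inv_apply_eq_inv', hχ]
    norm_num
  set Φ : ZMod n → ℂ := ZMod.dft (χ⁻¹ : DirichletCharacter ℂ n) with hΦdef
  have hΦ : Φ.Odd := ZMod.dft_odd_iff.mpr hodd.to_fun
  have hL : ∑ j, Φ j * (saw n j : ℂ) ≠ 0 := by
    intro h0
    have h1 := LFunction_dft_one_of_odd hΦ
    rw [h0, mul_zero, hΦdef, ZMod.dft_dft] at h1
    have h2 : (fun j => (n : ℂ) • (χ⁻¹ : DirichletCharacter ℂ n) (-j)) =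
        (-n : ℂ) • ((χ⁻¹ : DirichletCharacter ℂ n) : ZMod n → ℂ) := by
      ext j
      rw [hodd.to_fun j]
      simp
    rw [h2] at h1
    have h3 : ZMod.LFunction ((-n : ℂ) • ((χ⁻¹ : DirichletCharacter ℂ n) : ZMod n → ℂ)) 1 =
        -n * DirichletCharacter.LFunction χ⁻¹ 1 := by
      rw [DirichletCharacter.LFunction, ZMod.LFunction, ZMod.LFunction]
      simp only [Pi.smul_apply, smul_eq_mul, mul_assoc, ← Finset.mul_sum]
      ring
    rw [h3] at h1
    have hn : (n : ℂ) ≠ 0 := NeZero.ne _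
    exact mul_ne_zero (neg_ne_zero.mpr hn)
      (DirichletCharacter.LFunction_apply_one_ne_zero hne) h1
  have hmul : ∀ (u : (ZMod n)ˣ) j, Φ (j * u) = χ u * Φ j := by
    intro u j
    have h1 := ZMod.dft_comp_unitMul (χ⁻¹ : DirichletCharacter ℂ n) u⁻¹ j
    rw [inv_inv, mul_comm] at h1
    rw [hΦdef, ← h1]
    simp only [map_mul]
    rw [ZMod.dft_const_mul, MulChar.inv_apply_eq_inv']
    have : χ (u⁻¹ : (ZMod n)ˣ) * χ u = 1 := by rw [← map_mul]; simp
    rw [inv_eq_of_mul_eq_one_right this]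
  apply hL
  have hu : ∀ u : (ZMod n)ˣ, ∑ j, Φ j * (saw n j : ℂ) = ∑ j, Φ j * (χ u * (saw n (j * u) : ℂ)) := by
    intro u
    symm
    refine Fintype.sum_equiv (Units.mulRight u) _ _ fun j => ?_
    rw [Units.mulRight_apply, hmul]
    ring
  have h4 : ∑ u : (ZMod n)ˣ, ∑ j, Φ j * (saw n j : ℂ) = 0 := by
    rw [Finset.sum_congr rfl fun u _ => hu u, Finset.sum_comm]
    simp_rw [← Finset.mul_sum, H, mul_zero, Finset.sum_const_zero]
  rw [Finset.sum_const, smul_eq_zero] at h4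
  exact h4.resolve_left (Finset.card_ne_zero_of_mem (Finset.mem_univ 1))

end Stickelberger
end

/-! ### Distribution relations and stability of the sawtooth groups -/

noncomputable section
namespace Stickelberger

open Finset

theorem saw_natCast_of_lt {n m : ℕ} (h : m < n) :
    saw n (m : ZMod n) = 1 / 2 - (m : ℚ) / n - if m = 0 then 1 / 2 else 0 := by
  have h0 : ((m : ZMod n) = 0) ↔ m = 0 := by
    rw [ZMod.natCast_eq_zero_iff]
    exact ⟨fun hd => Nat.eq_zero_of_dvd_of_lt hd h, fun hm => hm ▸ dvd_zero n⟩
  rw [saw, ZMod.val_natCast, Nat.mod_eq_of_lt h]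
  by_cases hm : m = 0
  · simp [hm]
  · rw [if_neg (h0.not.mpr hm), if_neg hm, sub_zero]

theorem sum_filter_castHom_eq {M : Type*} [AddCommMonoid M] {n d k : ℕ} [NeZero n] [NeZero d]
    (hn : n = d * k) (f : ZMod n → M) (c : ZMod d) :
    ∑ x with ZMod.castHom (Dvd.intro k hn.symm) (ZMod d) x = c, f x =
      ∑ i ∈ range k, f ((c.val + d * i : ℕ) : ZMod n) := by
  have hd := NeZero.pos d
  symm
  refine Finset.sum_nbij' (fun i => ((c.val + d * i : ℕ) : ZMod n)) (fun x => x.val / d) ?_ ?_ ?_ ?_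
    fun _ _ => rfl
  · intro i _
    rw [mem_filter, map_natCast]
    exact ⟨mem_univ _, by simp⟩
  · intro x _
    rw [mem_range]
    exact Nat.div_lt_of_lt_mul (hn ▸ ZMod.val_lt x)
  · intro i hi
    rw [mem_range] at hi
    have hc := ZMod.val_lt c
    have : c.val + d * i < n := by rw [hn]; nlinarith
    rw [ZMod.val_natCast, Nat.mod_eq_of_lt this, Nat.add_mul_div_left _ _ hd,
      Nat.div_eq_of_lt hc, zero_add]
  · intro x hx
    rw [mem_filter] at hx
    have : c.val = x.val % d := by
      rw [← hx.2, ZMod.castHom_apply, ZMod.cast_eq_val, ZMod.val_natCast]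
    rw [this, Nat.mod_add_div, ZMod.natCast_zmod_val]

theorem card_filter_castHom_eq {n d k : ℕ} [NeZero n] [NeZero d] (hn : n = d * k) (c : ZMod d) :
    #{x | ZMod.castHom (Dvd.intro k hn.symm) (ZMod d) x = c} = k := by
  rw [Finset.card_eq_sum_ones, sum_filter_castHom_eq hn]
  simp

/-- Along the lifts c + di the terms form an arithmetic progression; the correction at zero enters
only for c = 0, i = 0. -/
theorem sum_saw_filter_castHom_eq {n d k : ℕ} [NeZero n] [NeZero d] (hn : n = d * k)
    (c : ZMod d) :
    ∑ x with ZMod.castHom (Dvd.intro k hn.symm) (ZMod d) x = c, saw n x = saw d c := by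
  have hk : 0 < k := Nat.pos_of_ne_zero fun h => NeZero.ne n (by simp [hn, h])
  have hd := NeZero.pos d
  have hc := ZMod.val_lt c
  rw [sum_filter_castHom_eq hn]
  have h1 : ∀ i ∈ range k, saw n ((c.val + d * i : ℕ) : ZMod n) =
      1 / 2 - (c.val : ℚ) / n - (i : ℚ) / k -
        if i = 0 then (if c.val = 0 then 1 / 2 else 0) else 0 := by
    intro i hi
    rw [mem_range] at hi
    have hkq : (k : ℚ) ≠ 0 := by positivity
    have hdq : (d : ℚ) ≠ 0 := by positivity
    have hlt : c.val + d * i < n := by rw [hn]; nlinarith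
    have h0 : c.val + d * i = 0 ↔ i = 0 ∧ c.val = 0 := by
      rw [Nat.add_eq_zero_iff, Nat.mul_eq_zero]
      omega
    rw [saw_natCast_of_lt hlt, ← ite_and]
    simp only [h0, hn]
    push_cast
    field_simp
    ring
  rw [Finset.sum_congr rfl h1]
  simp only [Finset.sum_sub_distrib, Finset.sum_const, card_range, nsmul_eq_mul, Finset.sum_ite_eq',
    mem_range, hk, if_true, ← Finset.sum_div]
  have h2 : (∑ i ∈ range k, (i : ℚ)) = k * (k - 1) / 2 := by
    have := Finset.sum_range_id_mul_two k
    have h3 : ((∑ i ∈ range k, i : ℕ) : ℚ) * 2 = k * (k - 1 : ℕ) := by exact_mod_cast this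
    rw [Nat.cast_sub hk] at h3
    push_cast at h3
    linarith
  have h4 := saw_natCast_of_lt hc
  rw [ZMod.natCast_zmod_val] at h4
  have hkq : (k : ℚ) ≠ 0 := by positivity
  have hdq : (d : ℚ) ≠ 0 := by positivity
  rw [h2, h4, hn]
  push_cast
  field_simp
  ring

theorem saw_mul_eq {n d k : ℕ} [NeZero n] (hn : n = d * k) (x : ZMod n) :
    saw n (k * x) = saw d (ZMod.castHom (Dvd.intro k hn.symm) (ZMod d) x) := by
  subst hn
  have hk : 0 < k := Nat.pos_of_ne_zero fun h => NeZero.ne (d * k) (by simp [h])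
  have hd : 0 < d := Nat.pos_of_ne_zero fun h => NeZero.ne (d * k) (by simp [h])
  have e1 : k * x = ((k * (x.val % d) : ℕ) : ZMod (d * k)) := by
    conv_lhs => rw [← ZMod.natCast_zmod_val x, ← Nat.cast_mul]
    rw [ZMod.natCast_eq_natCast_iff]
    generalize x.val = X
    rw [mul_comm d k]
    exact (Nat.mod_modEq X d).symm.mul_left' k
  have e2 : ZMod.castHom (Dvd.intro k rfl) (ZMod d) x = ((x.val % d : ℕ) : ZMod d) := by
    rw [ZMod.castHom_apply, ZMod.cast_eq_val, ZMod.natCast_mod]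
  have hlt := Nat.mod_lt x.val hd
  have hlt' : k * (x.val % d) < d * k := by nlinarith
  rw [e1, e2, saw_natCast_of_lt hlt, saw_natCast_of_lt hlt']
  have hkq : (k : ℚ) ≠ 0 := by positivity
  simp only [mul_eq_zero, hk.ne', false_or]
  push_cast
  rw [mul_comm (d : ℚ), mul_div_mul_left _ _ hkq]

/-- The function `u ↦ saw (a u)` on the units modulo `n`. -/
def sawFun (n : ℕ) (a : ZMod n) : (ZMod n)ˣ → ℚ := fun u => saw n (a * u)

/-- The additive group generated by the functions `sawFun n a`. -/
def sawSpan (n : ℕ) : AddSubgroup ((ZMod n)ˣ → ℚ) := AddSubgroup.closure (Set.range (sawFun n))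

theorem sawFun_mem_sawSpan {n : ℕ} (a : ZMod n) : sawFun n a ∈ sawSpan n :=
  AddSubgroup.subset_closure ⟨a, rfl⟩

/-- Summation over the fibres of the reduction map on units. -/
def fiberSum {d n : ℕ} [NeZero n] (h : d ∣ n) :
    ((ZMod n)ˣ → ℚ) →ₗ[ℚ] ((ZMod d)ˣ → ℚ) where
  toFun f v := ∑ u with ZMod.unitsMap h u = v, f u
  map_add' f g := by ext v; simp [Finset.sum_add_distrib]
  map_smul' c f := by ext v; simp [Finset.mul_sum]

theorem fiberSum_apply {d n : ℕ} [NeZero n] (h : d ∣ n) (f : (ZMod n)ˣ → ℚ) (v : (ZMod d)ˣ) :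
    fiberSum h f v = ∑ u with ZMod.unitsMap h u = v, f u := rfl

theorem fiberSum_self {n : ℕ} [NeZero n] (h : n ∣ n) (f : (ZMod n)ˣ → ℚ) : fiberSum h f = f := by
  ext v
  rw [fiberSum_apply, ZMod.unitsMap_self]
  simp [Finset.sum_filter]

theorem fiberSum_fiberSum {d m n : ℕ} [NeZero m] [NeZero n] (h : d ∣ m) (h' : m ∣ n)
    (f : (ZMod n)ˣ → ℚ) : fiberSum h (fiberSum h' f) = fiberSum (h.trans h') f := by
  ext v
  simp only [fiberSum_apply, ← ZMod.unitsMap_comp h h', MonoidHom.comp_apply]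
  rw [← Finset.sum_fiberwise_of_maps_to (t := univ.filter fun w => ZMod.unitsMap h w = v)
    (g := ZMod.unitsMap h') (by simp)]
  refine Finset.sum_congr rfl fun w hw => Finset.sum_congr ?_ fun _ _ => rfl
  rw [mem_filter] at hw
  ext u
  simp only [mem_filter, mem_univ, true_and]
  constructor
  · rintro rfl
    exact ⟨hw.2, rfl⟩
  · exact fun hu => hu.2

theorem sum_units_filter_eq {d n : ℕ} [NeZero n] (h : d ∣ n) (g : ZMod n → ℚ) (v : (ZMod d)ˣ) :
    ∑ u : (ZMod n)ˣ with ZMod.unitsMap h u = v, g u =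
      ∑ x with ZMod.castHom h (ZMod d) x = v, if IsUnit x then g x else 0 := by
  rw [← Finset.sum_filter]
  refine Finset.sum_bij (fun u _ => (u : ZMod n)) ?_ ?_ ?_ fun _ _ => rfl
  · intro u hu
    rw [mem_filter] at hu
    simp only [mem_filter, mem_univ, true_and]
    exact ⟨by rw [← hu.2]; rfl, u.isUnit⟩
  · intro u _ u' _ e
    exact Units.ext e
  · intro x hx
    simp only [mem_filter, mem_univ, true_and] at hx
    obtain ⟨u, rfl⟩ := hx.2
    exact ⟨u, mem_filter.mpr ⟨mem_univ _, Units.ext hx.1⟩, rfl⟩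

/-- Elements of a fibre differ by multiples of d = n/l, so l ∤ a makes multiplication by a injective
there. It carries the fibre over v onto the one over av, even if a and d share factors. -/
theorem sum_saw_mul_filter_castHom_eq {n d l : ℕ} [NeZero n] [NeZero d] (hl : l.Prime)
    (hn : n = d * l) (a : ℕ) (hla : ¬ l ∣ a) (v : ZMod d) :
    ∑ x with ZMod.castHom (Dvd.intro l hn.symm) (ZMod d) x = v, saw n (a * x) = saw d (a * v) := by
  have hinj : Set.InjOn (fun x : ZMod n => a * x)
      (univ.filter fun x => ZMod.castHom (Dvd.intro l hn.symm) (ZMod d) x = v) := by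
    intro x hx y hy hxy
    replace hx := (mem_filter.mp (mem_coe.mp hx)).2
    replace hy := (mem_filter.mp (mem_coe.mp hy)).2
    simp only at hxy
    have h1 : (d : ℤ) ∣ x.val - y.val := by
      rw [← ZMod.intCast_eq_intCast_iff_dvd_sub]
      rw [← hy, ZMod.castHom_apply, ZMod.castHom_apply, ZMod.cast_eq_val, ZMod.cast_eq_val] at hx
      exact_mod_cast hx.symm
    obtain ⟨t, ht⟩ := h1
    have h2 : (n : ℤ) ∣ a * (x.val - y.val) := by
      rw [← ZMod.intCast_zmod_eq_zero_iff_dvd]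
      push_cast
      rw [ZMod.natCast_zmod_val, ZMod.natCast_zmod_val, mul_sub, hxy, sub_self]
    have h3 : (l : ℤ) ∣ t := by
      rw [ht, hn, show (a : ℤ) * (d * t) = d * (a * t) by ring] at h2
      push_cast at h2
      have h4 := (mul_dvd_mul_iff_left (by exact_mod_cast NeZero.ne d)).mp h2
      exact ((Nat.prime_iff_prime_int.mp hl).dvd_or_dvd h4).resolve_left
        fun h => hla (by exact_mod_cast h)
    have h5 : (n : ℤ) ∣ x.val - y.val := by
      rw [ht, hn]
      push_cast
      exact mul_dvd_mul_left _ h3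
    rw [← ZMod.intCast_eq_intCast_iff_dvd_sub] at h5
    simpa using h5.symm
  have himg : (univ.filter fun x => ZMod.castHom (Dvd.intro l hn.symm) (ZMod d) x = v).image
      (fun x : ZMod n => a * x) =
      univ.filter fun x => ZMod.castHom (Dvd.intro l hn.symm) (ZMod d) x = a * v := by
    refine Finset.eq_of_subset_of_card_le ?_ ?_
    · intro y hy
      rw [mem_image] at hy
      obtain ⟨x, hx, rfl⟩ := hy
      rw [mem_filter] at hx ⊢
      exact ⟨mem_univ _, by rw [map_mul, hx.2, map_natCast]⟩
    · rw [Finset.card_image_of_injOn hinj, card_filter_castHom_eq hn,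
        card_filter_castHom_eq hn]
  rw [← sum_saw_filter_castHom_eq hn, ← himg, Finset.sum_image hinj]

theorem isUnit_iff_isUnit_castHom_of_dvd {n d l : ℕ} [NeZero n] (hn : n = d * l)
    (hld : l ∣ d) (x : ZMod n) (hx : IsUnit (ZMod.castHom (Dvd.intro l hn.symm) (ZMod d) x)) :
    IsUnit x := by
  subst hn
  rw [ZMod.castHom_apply, ZMod.cast_eq_val, ZMod.isUnit_iff_coprime] at hx
  rw [← ZMod.natCast_zmod_val x, ZMod.isUnit_iff_coprime]
  exact Nat.Coprime.mul_right hx (hx.coprime_dvd_right hld)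

/-- A lift of a unit modulo d fails to be a unit only if l divides it; since l is invertible modulo
d, exactly one lift does. -/
theorem not_isUnit_iff_of_castHom_eq {n d l : ℕ} [NeZero n] [NeZero d] (hl : l.Prime)
    (hn : n = d * l) (L : (ZMod d)ˣ) (hL : (L : ZMod d) = l) (v : (ZMod d)ˣ) (x : ZMod n)
    (hx : ZMod.castHom (Dvd.intro l hn.symm) (ZMod d) x = v) :
    ¬ IsUnit x ↔ x = l * (((L⁻¹ * v : (ZMod d)ˣ) : ZMod d).val : ZMod n) := by
  subst hn
  constructor
  · intro h
    have hu : IsUnit (ZMod.castHom (Dvd.intro l rfl) (ZMod d) x) := hx ▸ v.isUnit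
    have hl' : l ∣ x.val := by
      by_contra hlx
      apply h
      rw [ZMod.castHom_apply, ZMod.cast_eq_val, ZMod.isUnit_iff_coprime] at hu
      rw [← ZMod.natCast_zmod_val x, ZMod.isUnit_iff_coprime]
      exact hu.mul_right ((Nat.Prime.coprime_iff_not_dvd hl).mpr hlx).symm
    obtain ⟨y, hy⟩ := hl'
    have hyd : (y : ZMod d) = ((L⁻¹ * v : (ZMod d)ˣ) : ZMod d) := by
      rw [ZMod.castHom_apply, ZMod.cast_eq_val, hy, Nat.cast_mul, ← hL] at hx
      rw [Units.val_mul, ← hx, Units.inv_mul_cancel_left]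
    rw [← ZMod.natCast_zmod_val x, hy, ← Nat.cast_mul, ZMod.natCast_eq_natCast_iff, ← hyd,
      ZMod.val_natCast]
    exact mul_comm l d ▸ (Nat.mod_modEq y d).symm.mul_left' l
  · rintro rfl h
    rw [← Nat.cast_mul, ZMod.isUnit_iff_coprime] at h
    exact hl.one_lt.ne' (Nat.dvd_one.mp (h ▸ Nat.dvd_gcd (dvd_mul_right _ _) (dvd_mul_left _ _)))

/-- F sums over all lifts, where the distribution relation applies. Restricting to unit lifts
changes nothing if l ∣ d, and otherwise removes the single lift divisible by l, as an Euler factor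
would. -/
theorem fiberSum_sawFun_mem_of_prime {n d l : ℕ} [NeZero n] [NeZero d] (hl : l.Prime)
    (hn : n = d * l) (a : ZMod n) :
    fiberSum (Dvd.intro l hn.symm) (sawFun n a) ∈ sawSpan d := by
  set α := a.val with hα
  have ha : a = (α : ZMod n) := (ZMod.natCast_zmod_val a).symm
  let h := Dvd.intro l hn.symm
  let F : (ZMod d)ˣ → ℚ := fun v => ∑ x with ZMod.castHom h (ZMod d) x = v, saw n (a * x)
  have hF : F ∈ sawSpan d := by
    by_cases hla : l ∣ α
    · obtain ⟨β, hβ⟩ := hla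
      -- Here saw(ax) depends only on x modulo d, so the l terms of a fibre coincide.
      have : F = l • sawFun d β := by
        ext v
        have h1 : ∀ x ∈ univ.filter fun x => ZMod.castHom h (ZMod d) x = v,
            saw n (a * x) = saw d (β * v) := by
          intro x hx
          rw [mem_filter] at hx
          rw [ha, hβ, Nat.cast_mul, mul_assoc, saw_mul_eq hn, map_mul, hx.2, map_natCast]
        simp only [F]
        rw [Finset.sum_congr rfl h1, Finset.sum_const, card_filter_castHom_eq hn]
        rfl
      rw [this]
      exact nsmul_mem (sawFun_mem_sawSpan _) _
    · have : F = sawFun d α := by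
        ext v
        simp only [F, ha]
        rw [sum_saw_mul_filter_castHom_eq hl hn α hla]
        rfl
      rw [this]
      exact sawFun_mem_sawSpan _
  by_cases hld : l ∣ d
  · convert hF using 1
    ext v
    rw [fiberSum_apply]
    simp only [sawFun, F]
    rw [sum_units_filter_eq _ (fun x => saw n (a * x))]
    refine Finset.sum_congr rfl fun x hx => if_pos ?_
    rw [mem_filter] at hx
    exact isUnit_iff_isUnit_castHom_of_dvd hn hld x (hx.2 ▸ v.isUnit)
  · obtain ⟨L, hL⟩ := (ZMod.isUnit_prime_iff_not_dvd hl).mpr hld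
    have e : fiberSum h (sawFun n a) = F - sawFun d (α * (L⁻¹ : (ZMod d)ˣ)) := by
      ext v
      set x₀ : ZMod n := l * (((L⁻¹ * v : (ZMod d)ˣ) : ZMod d).val : ZMod n) with hx₀
      have hx₀v : ZMod.castHom h (ZMod d) x₀ = v := by
        rw [hx₀, map_mul, map_natCast, map_natCast, ZMod.natCast_zmod_val, ← hL, Units.val_mul,
          Units.mul_inv_cancel_left]
      have e1 : saw n (a * x₀) = sawFun d (α * (L⁻¹ : (ZMod d)ˣ)) v := by
        rw [hx₀, mul_left_comm, saw_mul_eq hn, map_mul, map_natCast, ZMod.natCast_zmod_val, ha,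
          map_natCast, sawFun, Units.val_mul, mul_assoc]
      rw [fiberSum_apply, Pi.sub_apply, ← e1]
      simp only [sawFun, F]
      rw [sum_units_filter_eq _ (fun x => saw n (a * x)), eq_sub_iff_add_eq,
        ← Finset.sum_ite_eq_of_mem' (univ.filter fun x => ZMod.castHom h (ZMod d) x = v) x₀
          (fun x => saw n (a * x)) (mem_filter.mpr ⟨mem_univ _, hx₀v⟩), ← Finset.sum_add_distrib]
      refine Finset.sum_congr rfl fun x hx => ?_
      rw [mem_filter] at hx
      have := not_isUnit_iff_of_castHom_eq hl hn L hL v x hx.2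
      by_cases hx' : x = x₀
      · rw [if_neg (this.mpr hx'), if_pos hx', zero_add]
      · rw [if_pos (not_not.mp (this.not.mpr hx')), if_neg hx', add_zero]
    rw [e]
    exact sub_mem hF (sawFun_mem_sawSpan _)

theorem map_mem_of_forall_generator {n : ℕ} {A : Type*} [AddCommGroup A] (S : AddSubgroup A)
    (φ : ((ZMod n)ˣ → ℚ) →+ A) (h : ∀ a, φ (sawFun n a) ∈ S) {f : (ZMod n)ˣ → ℚ}
    (hf : f ∈ sawSpan n) : φ f ∈ S := by
  have : sawSpan n ≤ S.comap φ := by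
    rw [sawSpan, AddSubgroup.closure_le]
    rintro _ ⟨a, rfl⟩
    exact h a
  exact this hf

theorem fiberSum_mem_sawSpan_aux (k : ℕ) : ∀ {d n : ℕ} [NeZero n] [NeZero d] (hn : n = d * k)
    (f : (ZMod n)ˣ → ℚ), f ∈ sawSpan n → fiberSum (Dvd.intro k hn.symm) f ∈ sawSpan d := by
  induction k using induction_on_primes with
  | zero => intro d n _ _ hn; exact absurd (by simpa using hn) (NeZero.ne n)
  | one =>
    intro d n _ _ hn f hf
    obtain rfl : n = d := by simpa using hn
    rwa [fiberSum_self]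
  | prime_mul l k hl ih =>
    intro d n _ _ hn f hf
    have hn' : n = (d * k) * l := by rw [hn]; ring
    have : NeZero (d * k) := ⟨fun h => NeZero.ne n (by rw [hn', h, zero_mul])⟩
    rw [← fiberSum_fiberSum (Dvd.intro k rfl) (Dvd.intro l hn'.symm)]
    exact ih rfl _ (map_mem_of_forall_generator _ (fiberSum _).toAddMonoidHom
      (fun a => fiberSum_sawFun_mem_of_prime hl hn' a) hf)

theorem fiberSum_mem_sawSpan {d n : ℕ} [NeZero n] [NeZero d] (h : d ∣ n) {f : (ZMod n)ˣ → ℚ}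
    (hf : f ∈ sawSpan n) : fiberSum h f ∈ sawSpan d := by
  obtain ⟨k, hk⟩ := h
  exact fiberSum_mem_sawSpan_aux k hk f hf

theorem sum_sawFun_filter_castHom_eq {n d k : ℕ} [NeZero n] [NeZero d] (hn : n = d * k)
    (b : ZMod d) (u : (ZMod n)ˣ) :
    ∑ x with ZMod.castHom (Dvd.intro k hn.symm) (ZMod d) x = b, sawFun n x u =
      saw d (b * ZMod.castHom (Dvd.intro k hn.symm) (ZMod d) u) := by
  rw [← sum_saw_filter_castHom_eq hn]
  refine Finset.sum_equiv (Units.mulRight u) (fun x => ?_) fun x _ => rfl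
  simp only [mem_filter, mem_univ, true_and, Units.mulRight_apply, map_mul]
  exact ((u.isUnit.map (ZMod.castHom (Dvd.intro k hn.symm) (ZMod d))).mul_left_inj).symm

/-- By the distribution relation, the pullback of `sawFun d b` is the sum of `sawFun n x` over the
lifts x of b. -/
theorem comp_unitsMap_mem_sawSpan {d n : ℕ} [NeZero n] [NeZero d] (h : d ∣ n)
    {f : (ZMod d)ˣ → ℚ} (hf : f ∈ sawSpan d) : f ∘ ZMod.unitsMap h ∈ sawSpan n := by
  obtain ⟨k, hk⟩ := h
  refine map_mem_of_forall_generator (sawSpan n)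
    (LinearMap.funLeft ℚ ℚ (ZMod.unitsMap (Dvd.intro k hk.symm))).toAddMonoidHom (fun b => ?_) hf
  have e : LinearMap.funLeft ℚ ℚ (ZMod.unitsMap (Dvd.intro k hk.symm)) (sawFun d b) =
      ∑ x with ZMod.castHom (Dvd.intro k hk.symm) (ZMod d) x = b, sawFun n x := by
    ext u
    rw [Finset.sum_apply, sum_sawFun_filter_castHom_eq hk]
    rfl
  change LinearMap.funLeft ℚ ℚ _ _ ∈ _
  rw [e]
  exact sum_mem fun x _ => sawFun_mem_sawSpan x

/-! ### Generation by the residues up to φ(q)/2 -/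

theorem sum_sawFun_eq_sawFun_mul {n d k : ℕ} [NeZero n] [NeZero d] (hn : n = d * k) (x : ZMod n) :
    ∑ y with ZMod.castHom (Dvd.intro k hn.symm) (ZMod d) y =
      ZMod.castHom (Dvd.intro k hn.symm) (ZMod d) x, sawFun n y = sawFun n (k * x) := by
  ext u
  rw [Finset.sum_apply, sum_sawFun_filter_castHom_eq hn, ← map_mul, ← saw_mul_eq hn, sawFun,
    mul_assoc]

theorem sawFun_neg {n : ℕ} [NeZero n] (x : ZMod n) : sawFun n (-x) = -sawFun n x := by
  ext u
  rw [sawFun, neg_mul, saw_neg]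
  rfl

theorem sawFun_zero (n : ℕ) : sawFun n 0 = 0 := by
  ext u
  rw [sawFun, zero_mul, saw_zero]
  rfl

/-- Oddness covers all residues within H of 0. The others are n - 2H - 1 = d - 1 consecutive
residues, so a class modulo d contains at most one of them, and the relation for the class of x
solves for it. -/
theorem sawFun_mem_of_forall_le {n d k H : ℕ} [NeZero n] [NeZero d] (hn : n = d * k)
    (hH : 2 * H + d = n) {S : AddSubgroup ((ZMod n)ˣ → ℚ)}
    (hS : ∀ a : ℕ, 1 ≤ a → a ≤ H → sawFun n a ∈ S) {x : ZMod n} (hx : sawFun n (k * x) ∈ S) :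
    sawFun n x ∈ S := by
  have hlow : ∀ y : ZMod n, y.val ≤ H → sawFun n y ∈ S := by
    intro y hy
    rcases Nat.eq_zero_or_pos y.val with h0 | h0
    · rw [(ZMod.val_eq_zero y).mp h0, sawFun_zero]
      exact zero_mem S
    · have := hS y.val h0 hy
      rwa [ZMod.natCast_zmod_val] at this
  have hout : ∀ y : ZMod n, (y.val ≤ H ∨ n ≤ y.val + H) → sawFun n y ∈ S := by
    rintro y (hy | hy)
    · exact hlow y hy
    · rcases eq_or_ne y 0 with rfl | h0
      · rw [sawFun_zero]
        exact zero_mem S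
      · have : NeZero y := ⟨h0⟩
        have := hlow (-y) (by rw [ZMod.val_neg_of_ne_zero]; omega)
        rw [sawFun_neg] at this
        exact neg_mem_iff.mp this
  by_cases hxo : x.val ≤ H ∨ n ≤ x.val + H
  · exact hout x hxo
  have hxm : x ∈ univ.filter fun y => ZMod.castHom (Dvd.intro k hn.symm) (ZMod d) y =
      ZMod.castHom (Dvd.intro k hn.symm) (ZMod d) x := mem_filter.mpr ⟨mem_univ x, rfl⟩
  rw [← sum_sawFun_eq_sawFun_mul hn, ← Finset.add_sum_erase _ _ hxm] at hx
  refine (add_mem_cancel_right (sum_mem fun y hy => ?_)).mp hx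
  apply hout
  rw [mem_erase, mem_filter, ZMod.castHom_apply, ZMod.castHom_apply, ZMod.cast_eq_val,
    ZMod.cast_eq_val, ZMod.natCast_eq_natCast_iff] at hy
  have hne : y.val ≠ x.val := fun h => hy.1 (ZMod.val_injective n h)
  rcases Nat.lt_or_gt_of_ne hne with hlt | hlt
  · have h1 := (Nat.modEq_iff_dvd' hlt.le).mp hy.2.2
    have := Nat.le_of_dvd (by omega) h1
    omega
  · have h1 := (Nat.modEq_iff_dvd' hlt.le).mp hy.2.2.symm
    have := Nat.le_of_dvd (by omega) h1
    omega

theorem sawSpan_le_of_forall_le_totient_half {p e : ℕ} [hp : Fact p.Prime] (hq : 2 < p ^ e)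
    {S : AddSubgroup ((ZMod (p ^ e))ˣ → ℚ)}
    (hS : ∀ a : ℕ, 1 ≤ a → a ≤ (p ^ e).totient / 2 → sawFun (p ^ e) a ∈ S) :
    sawSpan (p ^ e) ≤ S := by
  have he : 0 < e := Nat.pos_of_ne_zero fun h => by simp [h] at hq
  have hpp := hp.out
  have hn : p ^ e = p ^ (e - 1) * p := by rw [← pow_succ, Nat.sub_add_cancel he]
  have : NeZero (p ^ (e - 1)) := ⟨(pow_pos hpp.pos _).ne'⟩
  have : NeZero (p ^ e) := ⟨(pow_pos hpp.pos _).ne'⟩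
  have hH : 2 * ((p ^ e).totient / 2) + p ^ (e - 1) = p ^ e := by
    rw [Nat.two_mul_div_two_of_even (Nat.totient_even hq), Nat.totient_prime_pow hpp he,
      ← Nat.mul_succ, Nat.succ_eq_add_one, Nat.sub_add_cancel hpp.one_le, ← hn]
  -- Descent on the power of p in front of x, starting from p^e x = 0.
  have key : ∀ j : ℕ, j ≤ e → ∀ x : ZMod (p ^ e), sawFun (p ^ e) (p ^ (e - j) * x) ∈ S := by
    intro j
    induction j with
    | zero =>
      intro _ x
      have : ((p : ZMod (p ^ e)) ^ (e - 0)) = 0 := by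
        rw [Nat.sub_zero, ← Nat.cast_pow, ZMod.natCast_self]
      rw [this, zero_mul, sawFun_zero]
      exact zero_mem S
    | succ j ih =>
      intro hj x
      refine sawFun_mem_of_forall_le hn hH hS ?_
      rw [← mul_assoc, ← pow_succ', show e - (j + 1) + 1 = e - j by omega]
      exact ih (by omega) x
  rw [sawSpan, AddSubgroup.closure_le]
  rintro _ ⟨x, rfl⟩
  simpa using key e le_rfl x

end Stickelberger
end

/-! ### Linear independence through odd characters -/

noncomputable section
namespace Stickelberger

open Finset

/-- As -1 ≠ 1 modulo n, the sum of χ(-1) over all χ vanishes, so odd and even characters are equally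
many. -/
theorem card_odd_dirichletCharacter {n : ℕ} [NeZero n] (hn : 2 < n) :
    Nat.card {χ : DirichletCharacter ℂ n // χ.Odd} = n.totient / 2 := by
  classical
  have hneg : (-1 : ZMod n) ≠ 1 := by
    have : Fact (2 < n) := ⟨hn⟩
    exact ZMod.neg_one_ne_one
  have h0 := DirichletCharacter.sum_characters_eq_zero ℂ hneg
  have h1 : ∀ χ : DirichletCharacter ℂ n, χ (-1) = 1 - 2 * (if χ.Odd then 1 else 0) := by
    intro χ
    rcases χ.even_or_odd with h | h
    · have h' : ¬ χ.Odd := by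
        rw [DirichletCharacter.Odd, h]
        norm_num
      rw [h, if_neg h']
      norm_num
    · rw [if_pos h, h]
      norm_num
  rw [Finset.sum_congr rfl fun χ _ => h1 χ, Finset.sum_sub_distrib, ← Finset.mul_sum,
    Finset.sum_boole, Finset.sum_const, Finset.card_univ, ← Nat.card_eq_fintype_card,
    DirichletCharacter.card_eq_totient_of_hasEnoughRootsOfUnity, nsmul_one, sub_eq_zero] at h0
  have h2 : n.totient = 2 * #{χ : DirichletCharacter ℂ n | χ.Odd} := by exact_mod_cast h0
  rw [Nat.card_eq_fintype_card, Fintype.card_subtype]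
  omega

/-- The characters of `(ℤ/n)ˣ` consisting of the odd ones and the trivial one. -/
def oddOrTrivialHom (n : ℕ) : Option {χ : DirichletCharacter ℂ n // χ.Odd} → ((ZMod n)ˣ →* ℂ)
  | none => 1
  | some χ => (Units.coeHom ℂ).comp χ.1.toUnitHom

theorem oddOrTrivialHom_some_apply {n : ℕ} (χ : {χ : DirichletCharacter ℂ n // χ.Odd})
    (u : (ZMod n)ˣ) : oddOrTrivialHom n (some χ) u = χ.1 u := rfl

theorem oddOrTrivialHom_injective (n : ℕ) : Function.Injective (oddOrTrivialHom n) := by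
  have hne : ∀ χ : {χ : DirichletCharacter ℂ n // χ.Odd},
      oddOrTrivialHom n (some χ) ≠ oddOrTrivialHom n none := by
    intro χ h
    have h1 := DFunLike.congr_fun h (-1)
    rw [oddOrTrivialHom_some_apply, Units.val_neg, Units.val_one, χ.2] at h1
    have : (-1 : ℂ) = 1 := h1
    norm_num at this
  rintro (_ | χ) (_ | χ') h
  · rfl
  · exact absurd h.symm (hne _)
  · exact absurd h (hne _)
  · congr 1
    apply Subtype.ext
    refine MulChar.ext fun u => ?_
    exact DFunLike.congr_fun h u

/-- Extension of scalars from `ℚ` to `ℂ` for functions. -/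
def ratCastFun (α : Type*) : (α → ℚ) →+ (α → ℂ) where
  toFun f a := (f a : ℂ)
  map_zero' := by ext; simp
  map_add' f g := by ext; simp

theorem ratCastFun_apply {α : Type*} (f : α → ℚ) (a : α) : ratCastFun α f a = (f a : ℂ) := rfl

/-- Averaging the translates of `sawFun n j` against χ⁻¹ projects onto the line of χ with factor B,
and j is chosen so that B ≠ 0. -/
theorem odd_character_mem {n : ℕ} [NeZero n] {W : Submodule ℂ ((ZMod n)ˣ → ℂ)}
    (hW : ∀ x, ratCastFun _ (sawFun n x) ∈ W) {χ : DirichletCharacter ℂ n} (hχ : χ.Odd) :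
    (fun u : (ZMod n)ˣ => χ u) ∈ W := by
  have hodd : (χ⁻¹ : DirichletCharacter ℂ n).Odd := by
    rw [DirichletCharacter.Odd, MulChar.inv_apply_eq_inv', hχ]
    norm_num
  obtain ⟨j, hj⟩ := exists_sum_char_mul_saw_ne_zero hodd
  set B := ∑ u : (ZMod n)ˣ, (χ⁻¹ : DirichletCharacter ℂ n) u * (saw n (j * u) : ℂ)
  have e : ∑ t : (ZMod n)ˣ, (χ⁻¹ : DirichletCharacter ℂ n) t • ratCastFun _ (sawFun n (j * t)) =
      B • fun u : (ZMod n)ˣ => χ u := by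
    ext u
    rw [Finset.sum_apply, Pi.smul_apply, smul_eq_mul, Finset.sum_mul]
    refine Fintype.sum_equiv (Equiv.mulRight u) _ _ fun t => ?_
    have hu : (χ⁻¹ : DirichletCharacter ℂ n) u * χ u = 1 := by
      rw [← MulChar.mul_apply, inv_mul_cancel, MulChar.one_apply_coe]
    simp only [Equiv.coe_mulRight, Units.val_mul, map_mul, Pi.smul_apply, smul_eq_mul,
      ratCastFun_apply, sawFun, mul_assoc]
    linear_combination (-(χ⁻¹ : DirichletCharacter ℂ n) t * (saw n (j * (t * u)) : ℂ)) * hu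
  have h : B • (fun u : (ZMod n)ˣ => χ u) ∈ W :=
    e ▸ W.sum_mem fun t _ => W.smul_mem _ (hW _)
  exact (W.smul_mem_iff hj).mp h

instance fintypeMPrime (q : ℕ) : Fintype (MPrime q) :=
  inferInstanceAs (Fintype (Set.Icc (1 : ℤ) ((q.totient / 2 : ℕ) : ℤ)))

theorem card_MPrime (q : ℕ) : Fintype.card (MPrime q) = q.totient / 2 := by
  rw [← Nat.card_eq_fintype_card, MPrime, ← Finset.coe_Icc, Nat.card_coe_set_eq,
    Set.ncard_coe_finset, Int.card_Icc, add_sub_cancel_right, Int.toNat_natCast]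

/-- The functions `sawFun q a` for `a ∈ MPrime q` and the constant function `1/2`. -/
def sawBasis (q : ℕ) : Option (MPrime q) → ((ZMod q)ˣ → ℚ)
  | none => fun _ => 1 / 2
  | some a => sawFun q ((a : ℤ) : ZMod q)

theorem sawFun_mem_of_sawBasis_mem {p e : ℕ} [Fact p.Prime] (hq : 2 < p ^ e)
    {S : AddSubgroup ((ZMod (p ^ e))ˣ → ℚ)} (hS : ∀ a, sawBasis (p ^ e) (some a) ∈ S) :
    sawSpan (p ^ e) ≤ S := by
  refine sawSpan_le_of_forall_le_totient_half hq fun a h1 h2 => ?_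
  have := hS ⟨(a : ℤ), by exact_mod_cast h1, by exact_mod_cast h2⟩
  simpa [sawBasis] using this

theorem linearIndependent_sawBasis {p e : ℕ} [Fact p.Prime] (hq : 2 < p ^ e) :
    LinearIndependent ℤ (sawBasis (p ^ e)) := by
  have : NeZero (p ^ e) := ⟨by omega⟩
  refine LinearIndependent.of_comp (ratCastFun (ZMod (p ^ e))ˣ).toIntLinearMap ?_
  suffices h : LinearIndependent ℂ fun o => ratCastFun (ZMod (p ^ e))ˣ (sawBasis (p ^ e) o) from
    h.restrict_scalars' ℤ
  rw [linearIndependent_iff_card_le_finrank_span, Set.finrank]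
  set W := Submodule.span ℂ (Set.range fun o => ratCastFun (ZMod (p ^ e))ˣ (sawBasis (p ^ e) o))
  have hmem : ∀ o, ratCastFun (ZMod (p ^ e))ˣ (sawBasis (p ^ e) o) ∈ W :=
    fun o => Submodule.subset_span ⟨o, rfl⟩
  have hW : ∀ x, ratCastFun _ (sawFun (p ^ e) x) ∈ W := by
    -- Generation over ℤ, applied to W as an additive group, puts every `sawFun` in W, not only
    -- those of the family.
    have := sawFun_mem_of_sawBasis_mem hq (S := W.toAddSubgroup.comap (ratCastFun _))
      fun a => hmem (some a)
    exact fun x => this (sawFun_mem_sawSpan x)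
  have hli := (linearIndependent_monoidHom (ZMod (p ^ e))ˣ ℂ).comp _
    (oddOrTrivialHom_injective (p ^ e))
  have hle : Submodule.span ℂ (Set.range ((fun f : (ZMod (p ^ e))ˣ →* ℂ =>
      (f : (ZMod (p ^ e))ˣ → ℂ)) ∘ oddOrTrivialHom (p ^ e))) ≤ W := by
    rw [Submodule.span_le]
    rintro _ ⟨_ | χ, rfl⟩
    · have := W.smul_mem (2 : ℂ) (hmem none)
      have e : (2 : ℂ) • ratCastFun (ZMod (p ^ e))ˣ (sawBasis (p ^ e) none) =
          ((1 : (ZMod (p ^ e))ˣ →* ℂ) : (ZMod (p ^ e))ˣ → ℂ) := by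
        ext u
        simp [ratCastFun_apply, sawBasis]
      rwa [e] at this
    · exact odd_character_mem hW χ.2
  have : Fintype {χ : DirichletCharacter ℂ (p ^ e) // χ.Odd} := Fintype.ofFinite _
  calc Fintype.card (Option (MPrime (p ^ e)))
      = Fintype.card (Option {χ : DirichletCharacter ℂ (p ^ e) // χ.Odd}) := by
        rw [Fintype.card_option, Fintype.card_option, card_MPrime, ← card_odd_dirichletCharacter hq,
          Nat.card_eq_fintype_card]
    _ = _ := (finrank_span_eq_card hli).symm
    _ ≤ _ := Submodule.finrank_mono hle

end Stickelberger
end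

/-! ### Transfer to the group ring -/

noncomputable section
namespace Stickelberger

open Finset

instance numberField_cyc (m : ℕ) [NeZero m] : NumberField (Cyc m) where
  to_charZero := inferInstance
  to_finiteDimensional := finiteDimensional_cyc m

/-- The isomorphism `G_m ≃ (ℤ/m)ˣ`. -/
abbrev galUnits (m : ℕ) [NeZero m] : G m ≃* (ZMod m)ˣ :=
  IsCyclotomicExtension.Rat.galEquivZMod m (Cyc m)

theorem galUnits_sigma (m : ℕ) [NeZero m] {s : ℕ} (hs : s.Coprime m) :
    galUnits m (sigma m s) = ZMod.unitOfCoprime s hs := by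
  rw [sigma, dif_pos hs]
  exact MulEquiv.apply_symm_apply _ _

theorem galUnits_restrictGal {d n : ℕ} [NeZero d] [NeZero n] (h : d ∣ n) (σ : G n) :
    galUnits d (restrictGal h σ) = ZMod.unitsMap h (galUnits n σ) := by
  let _ : Algebra (Cyc d) (Cyc n) := (incl h).toRingHom.toAlgebra
  have _ : IsScalarTower ℚ (Cyc d) (Cyc n) :=
    IsScalarTower.of_algebraMap_eq fun x => ((incl h).commutes x).symm
  exact IsCyclotomicExtension.Rat.galEquivZMod_restrictNormal_apply n (Cyc n) (Cyc d) h σ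

/-- The element of `G_m` attached to a unit `u`, namely `σ_u⁻¹`. -/
def invGal (m : ℕ) [NeZero m] : (ZMod m)ˣ ≃ G m := (galUnits m).symm.toEquiv.trans (Equiv.inv _)

theorem invGal_apply (m : ℕ) [NeZero m] (u : (ZMod m)ˣ) :
    invGal m u = ((galUnits m).symm u)⁻¹ := rfl

theorem galUnits_invGal (m : ℕ) [NeZero m] (u : (ZMod m)ˣ) : galUnits m (invGal m u) = u⁻¹ := by
  rw [invGal_apply, map_inv, MulEquiv.apply_symm_apply]

theorem restrictGal_invGal {d n : ℕ} [NeZero d] [NeZero n] (h : d ∣ n) (u : (ZMod n)ˣ) :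
    restrictGal h (invGal n u) = invGal d (ZMod.unitsMap h u) := by
  apply (galUnits d).injective
  rw [galUnits_restrictGal, galUnits_invGal, galUnits_invGal, map_inv]

/-- The coefficient of `σ_u⁻¹` in an element of `ℚ[G_m]`, as a function of `u`. -/
def coeffFun (m : ℕ) [NeZero m] : GroupRing m →ₗ[ℚ] ((ZMod m)ˣ → ℚ) where
  toFun x u := x.coeff (invGal m u)
  map_add' x y := by ext; simp
  map_smul' c x := by ext; simp

theorem coeffFun_apply (m : ℕ) [NeZero m] (x : GroupRing m) (u : (ZMod m)ˣ) :
    coeffFun m x u = x.coeff (invGal m u) := rfl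

theorem coeffFun_injective (m : ℕ) [NeZero m] : Function.Injective (coeffFun m) := by
  intro x y h
  apply MonoidAlgebra.coeff_injective
  ext σ
  obtain ⟨u, rfl⟩ := (invGal m).surjective σ
  exact congrFun h u

theorem coeffFun_single (m : ℕ) [NeZero m] (v u : (ZMod m)ˣ) (c : ℚ) :
    coeffFun m (MonoidAlgebra.single (invGal m v) c) u = if v = u then c else 0 := by
  classical
  rw [coeffFun_apply, MonoidAlgebra.coeff_single, Finsupp.single_apply]
  simp only [(invGal m).injective.eq_iff]

theorem eq_sum_coeffFun (m : ℕ) [NeZero m] (x : GroupRing m) :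
    x = ∑ v, MonoidAlgebra.single (invGal m v) (coeffFun m x v) := by
  apply coeffFun_injective m
  ext u
  rw [map_sum, Finset.sum_apply]
  simp only [coeffFun_single, Finset.sum_ite_eq', mem_univ, if_true]

theorem coeffFun_normElt (m : ℕ) [NeZero m] : coeffFun m (normElt m) = 1 := by
  ext u
  rw [normElt, ← (invGal m).sum_comp fun τ => MonoidAlgebra.single τ (1 : ℚ), map_sum,
    Finset.sum_apply]
  simp only [coeffFun_single, Finset.sum_ite_eq', mem_univ, if_true, Pi.one_apply]

theorem coeffFun_res {d n : ℕ} [NeZero d] [NeZero n] (h : d ∣ n) (x : GroupRing n) :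
    coeffFun d (res h x) = fiberSum h (coeffFun n x) := by
  ext v
  conv_lhs => rw [eq_sum_coeffFun n x]
  rw [map_sum, map_sum, Finset.sum_apply, fiberSum_apply, Finset.sum_filter]
  refine Finset.sum_congr rfl fun u _ => ?_
  rw [res, MonoidAlgebra.mapDomainAlgHom_apply, MonoidAlgebra.mapDomain_single,
    restrictGal_invGal, coeffFun_single]

theorem cor_single {d m : ℕ} [NeZero d] [NeZero m] (h : d ∣ m) (v : (ZMod d)ˣ) (c : ℚ) :
    coeffFun m (cor h (MonoidAlgebra.single (invGal d v) c)) =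
      fun u => if v = ZMod.unitsMap h u then c else 0 := by
  classical
  ext u
  rw [cor, LinearMap.comp_apply]
  change coeffFun m (Finsupp.linearCombination ℚ _ (Finsupp.single (invGal d v) c)) u = _
  rw [Finsupp.linearCombination_single, map_smul, map_sum, Pi.smul_apply, Finset.sum_apply,
    Finset.sum_filter, ← (invGal m).sum_comp]
  simp only [coeffFun_single, restrictGal_invGal, (invGal d).injective.eq_iff]
  rw [Finset.sum_eq_single u (fun w _ hw => by simp [hw]) (by simp)]
  by_cases hv : v = ZMod.unitsMap h u
  · simp [hv]
  · simp [hv, Ne.symm hv]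

theorem coeffFun_cor {d m : ℕ} [NeZero d] [NeZero m] (h : d ∣ m) (x : GroupRing d) :
    coeffFun m (cor h x) = coeffFun d x ∘ ZMod.unitsMap h := by
  ext u
  conv_lhs => rw [eq_sum_coeffFun d x]
  rw [map_sum, map_sum, Finset.sum_apply]
  simp only [cor_single, Finset.sum_ite_eq', mem_univ, if_true, Function.comp]

theorem fract_neg_intCast_div_eq (m : ℕ) [NeZero m] (b : ℤ) :
    Int.fract (-((b : ℚ) / m)) = saw m b + if (b : ZMod m) = 0 then 0 else 1 / 2 := by
  have hm : (0 : ℚ) < m := by exact_mod_cast NeZero.pos m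
  have hmod : b = (b : ZMod m).val + m * (b / m) := by
    rw [ZMod.val_intCast, Int.emod_add_mul_ediv]
  have e : -((b : ℚ) / m) = -(((b : ZMod m).val : ℚ) / m) + (-(b / (m : ℤ)) : ℤ) := by
    have : (b : ℚ) = (b : ZMod m).val + m * ((b / (m : ℤ) : ℤ) : ℚ) := by exact_mod_cast hmod
    rw [this]
    push_cast
    field_simp
    ring_nf
  rw [e, Int.fract_add_intCast]
  by_cases h0 : (b : ZMod m) = 0
  · simp [h0, saw]
  · have hpos : 0 < (b : ZMod m).val := ZMod.val_pos.mpr h0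
    have hlt := ZMod.val_lt (b : ZMod m)
    rw [if_neg h0, saw, if_neg h0, Int.fract_eq_iff]
    have h1 : (0 : ℚ) < ((b : ZMod m).val : ℚ) / m := by positivity
    have h2 : ((b : ZMod m).val : ℚ) / m < 1 := by
      rw [div_lt_one hm]
      exact_mod_cast hlt
    refine ⟨by linarith, by linarith, -1, ?_⟩
    push_cast
    ring

theorem coeffFun_theta (m : ℕ) [NeZero m] (a : ℤ) :
    coeffFun m (theta m a) = sawFun m a + fun _ => if (a : ZMod m) = 0 then 0 else 1 / 2 := by
  ext u
  obtain ⟨s₀, hs₀, hs₀u⟩ : ∃ s ∈ Ioc 0 m, (s : ZMod m) = u := by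
    -- A unit is zero only for m = 1, where its representative in (0, m] is m itself.
    by_cases h0 : (u : ZMod m) = 0
    · exact ⟨m, mem_Ioc.mpr ⟨NeZero.pos m, le_rfl⟩, by rw [h0, ZMod.natCast_self]⟩
    · exact ⟨(u : ZMod m).val, mem_Ioc.mpr ⟨ZMod.val_pos.mpr h0, (ZMod.val_lt _).le⟩,
        ZMod.natCast_zmod_val _⟩
  have hc : s₀.Coprime m := (ZMod.isUnit_iff_coprime s₀ m).mp (hs₀u ▸ u.isUnit)
  have hsig : ∀ s (hs : s.Coprime m), (sigma m s)⁻¹ = invGal m (ZMod.unitOfCoprime s hs) := by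
    intro s hs
    rw [invGal_apply, ← galUnits_sigma m hs, MulEquiv.symm_apply_apply]
  rw [theta, map_sum, Finset.sum_apply, Finset.sum_eq_single s₀]
  · have hu : ZMod.unitOfCoprime s₀ hc = u := Units.ext hs₀u
    rw [hsig s₀ hc, coeffFun_single, if_pos hu]
    have := fract_neg_intCast_div_eq m (a * s₀)
    push_cast at this
    rw [this, hs₀u]
    simp only [Pi.add_apply, sawFun, Units.mul_left_eq_zero]
  · intro s hs hne
    rw [mem_filter, mem_Ioc] at hs
    rw [mem_Ioc] at hs₀
    rw [hsig s hs.2, coeffFun_single, if_neg]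
    intro h
    apply hne
    have h1 : (s : ZMod m) = s₀ := by rw [hs₀u, ← h]; rfl
    rw [ZMod.natCast_eq_natCast_iff] at h1
    rcases lt_trichotomy s s₀ with hlt | heq | hlt
    · have := Nat.le_of_dvd (by omega) ((Nat.modEq_iff_dvd' hlt.le).mp h1)
      omega
    · exact heq
    · have := Nat.le_of_dvd (by omega) ((Nat.modEq_iff_dvd' hlt.le).mp h1.symm)
      omega
  · exact fun h => absurd (mem_filter.mpr ⟨hs₀, hc⟩) h

theorem coeffFun_omega (m : ℕ) [NeZero m] (a : ℤ) : coeffFun m (omega m a) = sawFun m a := by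
  by_cases h : (m : ℤ) ∣ a
  · rw [omega, if_pos h, map_zero, (ZMod.intCast_zmod_eq_zero_iff_dvd a m).mpr h, sawFun_zero]
  · have h' : (a : ZMod m) ≠ 0 := fun h0 => h ((ZMod.intCast_zmod_eq_zero_iff_dvd a m).mp h0)
    rw [omega, if_neg h, map_sub, map_smul, coeffFun_theta, coeffFun_normElt]
    ext u
    simp [h']

theorem coeffFun_thetaUp (m n : ℕ) [NeZero m] [NeZero n] (a : ℤ) :
    coeffFun m (thetaUp m n a) =
      fiberSum (Nat.gcd_dvd_right m n) (coeffFun n (theta n a)) ∘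
        ZMod.unitsMap (Nat.gcd_dvd_left m n) := by
  rw [thetaUp, coeffFun_cor, coeffFun_res]

theorem fiberSum_const {d n : ℕ} [NeZero n] (h : d ∣ n) (c : ℚ) :
    ∃ k : ℕ, fiberSum h (fun _ => c) = fun _ => k • c := by
  classical
  refine ⟨#{u | ZMod.unitsMap h u = 1}, ?_⟩
  ext v
  rw [fiberSum_apply, Finset.sum_const]
  congr 1
  exact MonoidHom.card_fiber_eq_of_mem_range _ (ZMod.unitsMap_surjective h v)
    (ZMod.unitsMap_surjective h 1)

/-- The sawtooth part stays in `sawSpan`; the constant part becomes an integer multiple of ½, as all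
fibres of reduction on units have the same size. -/
theorem coeffFun_thetaUp_mem {m n : ℕ} [NeZero m] [NeZero n] (a : ℤ)
    {S : AddSubgroup ((ZMod m)ˣ → ℚ)} (h1 : sawSpan m ≤ S) (h2 : (fun _ => 1 / 2) ∈ S) :
    coeffFun m (thetaUp m n a) ∈ S := by
  rw [coeffFun_thetaUp, coeffFun_theta, map_add]
  refine S.add_mem (h1 (comp_unitsMap_mem_sawSpan _
    (fiberSum_mem_sawSpan _ (sawFun_mem_sawSpan _)))) ?_
  obtain ⟨k, hk⟩ := fiberSum_const (Nat.gcd_dvd_right m n) (if (a : ZMod n) = 0 then 0 else 1 / 2)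
  rw [hk]
  have : (fun _ => k • if (a : ZMod n) = 0 then (0 : ℚ) else 1 / 2) ∘
      ZMod.unitsMap (Nat.gcd_dvd_left m n) =
      k • if (a : ZMod n) = 0 then (0 : (ZMod m)ˣ → ℚ) else fun _ => 1 / 2 := by
    ext u
    by_cases h : (a : ZMod n) = 0 <;> simp [h]
  refine (congrArg (· ∈ S) this).mpr (nsmul_mem ?_ k)
  split_ifs
  · exact S.zero_mem
  · exact h2

theorem thetaUp_mem_SPrime (m n : ℕ) [NeZero m] [hn : NeZero n] (a : ℤ) :
    thetaUp m n a ∈ SPrime m := AddSubgroup.subset_closure ⟨n, hn, a, rfl⟩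

/-- A variable d with d = n allows substitution, which `Nat.gcd m m` in place of d would not. -/
theorem fiberSum_comp_unitsMap_of_eq {d n : ℕ} [NeZero n] (e : d = n) (h h' : d ∣ n)
    (f : (ZMod n)ˣ → ℚ) : fiberSum h f ∘ ZMod.unitsMap h' = f := by
  subst e
  rw [fiberSum_self, ZMod.unitsMap_self]
  rfl

theorem theta_mem_SPrime (m : ℕ) [NeZero m] (a : ℤ) : theta m a ∈ SPrime m := by
  have : theta m a = thetaUp m m a := by
    apply coeffFun_injective m
    rw [coeffFun_thetaUp, fiberSum_comp_unitsMap_of_eq (Nat.gcd_self m)]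
  rw [this]
  exact thetaUp_mem_SPrime m m a

/-- Take n = 2, a = 1: the unit groups modulo 2 and gcd(m, 2) are trivial and θ_2(1) is the constant
½, which corestricts to ½ N_m. -/
theorem half_normElt_mem_SPrime (m : ℕ) [NeZero m] : (1 / 2 : ℚ) • normElt m ∈ SPrime m := by
  have : (1 / 2 : ℚ) • normElt m = thetaUp m 2 1 := by
    apply coeffFun_injective m
    rw [coeffFun_thetaUp, coeffFun_theta, map_smul, coeffFun_normElt]
    ext u
    have hv : ∀ v : (ZMod 2)ˣ,
        ZMod.unitsMap (Nat.gcd_dvd_right m 2) v = ZMod.unitsMap (Nat.gcd_dvd_left m 2) u := by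
      obtain ⟨w, hw⟩ := ZMod.unitsMap_surjective (Nat.gcd_dvd_right m 2)
        (ZMod.unitsMap (Nat.gcd_dvd_left m 2) u)
      intro v
      rw [← hw, Subsingleton.elim v w]
    rw [Function.comp_apply, fiberSum_apply, Finset.filter_true_of_mem fun v _ => hv v,
      Fintype.sum_subsingleton _ (1 : (ZMod 2)ˣ)]
    have h1 : (1 : ZMod 2) ≠ 0 := by decide
    have h2 : (1 : ZMod 2).val = 1 := rfl
    simp [sawFun, saw, h2]
  rw [this]
  exact thetaUp_mem_SPrime m 2 1

theorem omega_mem_SPrime (m : ℕ) [NeZero m] (a : ℤ) : omega m a ∈ SPrime m := by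
  rw [omega]
  split_ifs
  · exact zero_mem _
  · exact sub_mem (theta_mem_SPrime m a) (half_normElt_mem_SPrime m)

/-- The elements `ω_q(a)` for `a ∈ MPrime q` and `½ N_q`, as elements of `SPrime q`. -/
def sPrimeFamily (q : ℕ) [NeZero q] : Option (MPrime q) → SPrime q
  | none => ⟨(1 / 2 : ℚ) • normElt q, half_normElt_mem_SPrime q⟩
  | some a => ⟨omega q a, omega_mem_SPrime q a⟩

theorem coeffFun_sPrimeFamily (q : ℕ) [NeZero q] (o : Option (MPrime q)) :
    coeffFun q (sPrimeFamily q o) = sawBasis q o := by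
  rcases o with _ | a
  · simp only [sPrimeFamily, sawBasis, map_smul, coeffFun_normElt]
    ext
    simp
  · exact coeffFun_omega q a

/-- The restriction of `coeffFun` to `SPrime q`, as a `ℤ`-linear map. -/
def coeffFunSPrime (q : ℕ) [NeZero q] : SPrime q →ₗ[ℤ] ((ZMod q)ˣ → ℚ) :=
  ((coeffFun q).toAddMonoidHom.comp (SPrime q).subtype).toIntLinearMap

theorem linearIndependent_sPrimeFamily {p e : ℕ} [Fact p.Prime] [NeZero (p ^ e)]
    (hq : 2 < p ^ e) : LinearIndependent ℤ (sPrimeFamily (p ^ e)) := by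
  refine LinearIndependent.of_comp (coeffFunSPrime (p ^ e)) ?_
  have : coeffFunSPrime (p ^ e) ∘ sPrimeFamily (p ^ e) = sawBasis (p ^ e) :=
    funext (coeffFun_sPrimeFamily (p ^ e))
  rw [this]
  exact linearIndependent_sawBasis hq

/-- `coeffFun` is injective, so membership can be tested on functions, where the span of the family
contains the image of every generator. -/
theorem span_sPrimeFamily {p e : ℕ} [Fact p.Prime] [NeZero (p ^ e)] (hq : 2 < p ^ e) :
    ⊤ ≤ Submodule.span ℤ (Set.range (sPrimeFamily (p ^ e))) := by
  set V := Submodule.span ℤ (Set.range (sPrimeFamily (p ^ e)))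
  let S : AddSubgroup ((ZMod (p ^ e))ˣ → ℚ) := (V.map (coeffFunSPrime (p ^ e))).toAddSubgroup
  have hS : ∀ o, sawBasis (p ^ e) o ∈ S := fun o =>
    ⟨sPrimeFamily (p ^ e) o, Submodule.subset_span ⟨o, rfl⟩, coeffFun_sPrimeFamily _ o⟩
  have hle : SPrime (p ^ e) ≤ S.comap (coeffFun (p ^ e)).toAddMonoidHom := by
    rw [SPrime, AddSubgroup.closure_le]
    rintro _ ⟨n, hn, a, rfl⟩
    exact coeffFun_thetaUp_mem a (sawFun_mem_of_sawBasis_mem hq fun a => hS (some a)) (hS none)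
  rintro ⟨x, hx⟩ -
  obtain ⟨y, hy, hyx⟩ := hle hx
  have : y = ⟨x, hx⟩ := Subtype.ext (coeffFun_injective _ hyx)
  exact this ▸ hy

end Stickelberger
end

theorem mainTheorem6 (p e : ℕ) [Fact p.Prime] (hq : 2 < p ^ e) :
    ∃ b : Module.Basis (Option (Stickelberger.MPrime (p ^ e))) ℤ (Stickelberger.SPrime (p ^ e)),
      (∀ a : Stickelberger.MPrime (p ^ e),
        (b (some a) : Stickelberger.GroupRing (p ^ e)) = Stickelberger.omega (p ^ e) a) ∧
      (b none : Stickelberger.GroupRing (p ^ e)) =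
        (1 / 2 : ℚ) • Stickelberger.normElt (p ^ e) := by
  refine ⟨Module.Basis.mk (Stickelberger.linearIndependent_sPrimeFamily hq)
    (Stickelberger.span_sPrimeFamily hq), fun a => ?_, ?_⟩ <;>
  · rw [Module.Basis.mk_apply]
    rfl
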